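/- Let $\Bbbk$ be a field of characteristic $0$, let $q$ be transcendental over $\Bbbk$, and let $F=\Bbbk(q)$ be the field of fractions of $\Bbbk[q,q^{-1}]$. Let $U_q=U_q(\mathfrak{sl}(2|1))$ be the associative unital $F$-algebra generated by $k_1^{\pm1},k_2^{\pm1},e_1,e_2,f_1,f_2$ subject to the relations \[ k_1k_1^{-1}=k_1^{-1}k_1=1,\quad k_2k_2^{-1}=k_2^{-1}k_2=1,\quad k_2k_1=k_1k_2, \] \[ e_1k_1=q^{-2}k_1e_1,\quad e_2k_1=qk_1e_2,\quad e_1k_2=qk_2e_1,\quad e_2k_2=k_2e_2, \] \[ k_1f_1=q^{-2}f_1k_1,\quad k_1f_2=qf_2k_1,\quad k_2f_1=qf_1k_2,\quad k_2f_2=f_2k_2, \] \[ e_1f_1=f_1e_1+\frac{k_1-k_1^{-1}}{q-q^{-1}},\quad e_2f_2=-f_2e_2+\frac{k_2-k_2^{-1}}{q-q^{-1}}, \] \[ e_1f_2=f_2e_1,\quad e_2f_1=f_1e_2,\quad e_2^2=f_2^2=0, \] \[ e_1^2e_2-(q+q^{-1})e_1e_2e_1+e_2e_1^2=0,\quad f_1^2f_2-(q+q^{-1})f_1f_2f_1+f_2f_1^2=0,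 \] and put $e_3:=e_1e_2-q^{-1}e_2e_1$ and $f_3:=f_2f_1-qf_1f_2$. Then the ordered monomials \[ f_1^w f_3^s f_2^l k_1^i k_2^j e_1^r e_3^h e_2^t,\qquad i,j\in\mathbb{Z},\ w,r\in\mathbb{Z}_{\ge 0},\ l,s,t,h\in\{0,1\}, \] are pairwise distinct and form a basis of $U_q$ as a vector space over $F$. -/

import Mathlib

namespace QuantumSl21

/-- The generators `k₁, k₁⁻¹, k₂, k₂⁻¹, e₁, e₂, f₁, f₂` of `U_q(sl(2|1))`. -/
inductive Gen : Type
  | k₁ | k₁inv | k₂ | k₂inv | e₁ | e₂ | f₁ | f₂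

/-- A generator, viewed in the free unital associative `F`-algebra on all the generators. -/
abbrev gen (F : Type*) [Field F] (x : Gen) : FreeAlgebra F Gen := FreeAlgebra.ι F x

/-- The defining relations of `U_q(sl(2|1))` over a field `F` with parameter `q`. -/
inductive Rel (F : Type*) [Field F] (q : F) : FreeAlgebra F Gen → FreeAlgebra F Gen → Prop
  | k₁_mul_inv : Rel F q (gen F .k₁ * gen F .k₁inv) 1
  | k₁_inv_mul : Rel F q (gen F .k₁inv * gen F .k₁) 1
  | k₂_mul_inv : Rel F q (gen F .k₂ * gen F .k₂inv) 1
  | k₂_inv_mul : Rel F q (gen F .k₂inv * gen F .k₂) 1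
  | k₂_k₁ : Rel F q (gen F .k₂ * gen F .k₁) (gen F .k₁ * gen F .k₂)
  | e₁_k₁ : Rel F q (gen F .e₁ * gen F .k₁) ((q⁻¹ ^ 2) • (gen F .k₁ * gen F .e₁))
  | e₂_k₁ : Rel F q (gen F .e₂ * gen F .k₁) (q • (gen F .k₁ * gen F .e₂))
  | e₁_k₂ : Rel F q (gen F .e₁ * gen F .k₂) (q • (gen F .k₂ * gen F .e₁))
  | e₂_k₂ : Rel F q (gen F .e₂ * gen F .k₂) (gen F .k₂ * gen F .e₂)
  | k₁_f₁ : Rel F q (gen F .k₁ * gen F .f₁) ((q⁻¹ ^ 2) • (gen F .f₁ * gen F .k₁))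
  | k₁_f₂ : Rel F q (gen F .k₁ * gen F .f₂) (q • (gen F .f₂ * gen F .k₁))
  | k₂_f₁ : Rel F q (gen F .k₂ * gen F .f₁) (q • (gen F .f₁ * gen F .k₂))
  | k₂_f₂ : Rel F q (gen F .k₂ * gen F .f₂) (gen F .f₂ * gen F .k₂)
  | e₁_f₁ : Rel F q (gen F .e₁ * gen F .f₁)
      (gen F .f₁ * gen F .e₁ + (q - q⁻¹)⁻¹ • (gen F .k₁ - gen F .k₁inv))
  | e₂_f₂ : Rel F q (gen F .e₂ * gen F .f₂)
      (-(gen F .f₂ * gen F .e₂) + (q - q⁻¹)⁻¹ • (gen F .k₂ - gen F .k₂inv))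
  | e₁_f₂ : Rel F q (gen F .e₁ * gen F .f₂) (gen F .f₂ * gen F .e₁)
  | e₂_f₁ : Rel F q (gen F .e₂ * gen F .f₁) (gen F .f₁ * gen F .e₂)
  | e₂_sq : Rel F q (gen F .e₂ ^ 2) 0
  | f₂_sq : Rel F q (gen F .f₂ ^ 2) 0
  | e_serre : Rel F q
      (gen F .e₁ ^ 2 * gen F .e₂ - (q + q⁻¹) • (gen F .e₁ * gen F .e₂ * gen F .e₁)
        + gen F .e₂ * gen F .e₁ ^ 2) 0
  | f_serre : Rel F q
      (gen F .f₁ ^ 2 * gen F .f₂ - (q + q⁻¹) • (gen F .f₁ * gen F .f₂ * gen F .f₁)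
        + gen F .f₂ * gen F .f₁ ^ 2) 0

/-- The unital associative `F`-algebra `U_q = U_q(sl(2|1))`, by generators and relations. -/
def Uq (F : Type*) [Field F] (q : F) : Type _ := RingQuot (Rel F q)

noncomputable section

instance (F : Type*) [Field F] (q : F) : Ring (Uq F q) :=
  inferInstanceAs (Ring (RingQuot (Rel F q)))

instance (F : Type*) [Field F] (q : F) : Algebra F (Uq F q) :=
  inferInstanceAs (Algebra F (RingQuot (Rel F q)))

namespace Uq

variable {F : Type*} [Field F]

/-- The canonical projection of the free algebra onto `U_q`. -/
def proj (q : F) : FreeAlgebra F Gen →ₐ[F] Uq F q := RingQuot.mkAlgHom F (Rel F q)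

theorem proj_eq_of_rel (q : F) {x y : FreeAlgebra F Gen} (h : Rel F q x y) :
    proj q x = proj q y := RingQuot.mkAlgHom_rel F h

/-- `k₁` as an invertible element of `U_q`, so that `k₁ ^ i` makes sense for `i : ℤ`. -/
def k₁ (q : F) : (Uq F q)ˣ where
  val := proj q (gen F .k₁)
  inv := proj q (gen F .k₁inv)
  val_inv := by rw [← map_mul, proj_eq_of_rel q .k₁_mul_inv, map_one]
  inv_val := by rw [← map_mul, proj_eq_of_rel q .k₁_inv_mul, map_one]

/-- `k₂` as an invertible element of `U_q`. -/
def k₂ (q : F) : (Uq F q)ˣ where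
  val := proj q (gen F .k₂)
  inv := proj q (gen F .k₂inv)
  val_inv := by rw [← map_mul, proj_eq_of_rel q .k₂_mul_inv, map_one]
  inv_val := by rw [← map_mul, proj_eq_of_rel q .k₂_inv_mul, map_one]

def e₁ (q : F) : Uq F q := proj q (gen F .e₁)
def e₂ (q : F) : Uq F q := proj q (gen F .e₂)
def f₁ (q : F) : Uq F q := proj q (gen F .f₁)
def f₂ (q : F) : Uq F q := proj q (gen F .f₂)

def e₃ (q : F) : Uq F q := e₁ q * e₂ q - q⁻¹ • (e₂ q * e₁ q)
def f₃ (q : F) : Uq F q := f₂ q * f₁ q - q • (f₁ q * f₂ q)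

/-- The ordered monomial `f₁ʷ f₃ˢ f₂ˡ k₁ⁱ k₂ʲ e₁ʳ e₃ʰ e₂ᵗ` attached to the tuple of exponents
`(w, s, l, i, j, r, h, t)`. -/
def monomial (q : F) :
    ℕ × Fin 2 × Fin 2 × ℤ × ℤ × ℕ × Fin 2 × Fin 2 → Uq F q :=
  fun (w, s, l, i, j, r, h, t) =>
    f₁ q ^ w * f₃ q ^ (s : ℕ) * f₂ q ^ (l : ℕ)
      * ((k₁ q ^ i : (Uq F q)ˣ) : Uq F q) * ((k₂ q ^ j : (Uq F q)ˣ) : Uq F q)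
      * e₁ q ^ r * e₃ q ^ (h : ℕ) * e₂ q ^ (t : ℕ)

end Uq

end

end QuantumSl21

/-!
The monomials span because `U_q = N⁻ T N⁺`, where `N⁻`, `T`, `N⁺` are the subalgebras generated by
the `fᵢ`, the `kᵢ^{±1}` and the `eᵢ`: the relations move an `e` past a `k` or an `f`, and a `k` past
an `f`, at the cost of a scalar and of an element of `T`. Submodules of an algebra form a Kleene
algebra in which `S∗` is the subalgebra generated by `S`, so this is the inequality
`(a + b + c)∗ ≤ a∗ b∗ c∗`. The Serre relations and `e₂² = f₂² = 0` make `e₃` and `f₃` skew-commute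
with the generators and square to zero, which orders the monomials inside `N⁺` and `N⁻`.

They are independent because `U_q` acts on the module induced from the regular representation of
the Borel subalgebra `T N⁺`, written down explicitly: the monomials send the vector `1 ⊗ 1` to
nonzero multiples of distinct basis vectors. On a module `N⁻ ⊗ W` the relations between an `eᵢ` or
`kᵢ` and an `fⱼ` are checked by direct computation. The relations among the `eᵢ` and `kᵢ` are not:
the difference `X` of the two sides of such a relation commutes up to scalars with `f₁` and `f₂`,
so it vanishes as soon as it vanishes on `1 ⊗ W`, where the relation holds by assumption.
-/

namespace QuantumSl21

noncomputable section

open Finsupp (single lsingle)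
open Module (End)

/-! ### Ordered spanning sets -/

section Spanning

open Submodule
open scoped Computability

section KleeneAlgebra

variable {K : Type*} [KleeneAlgebra K] {a b c x : K}

theorem mul_kstar_le_kstar_mul (h : x * a ≤ a * x + x) : x * a∗ ≤ a∗ * x := by
  have hx : x ≤ a∗ * x := le_mul_of_one_le_left' one_le_kstar
  refine mul_kstar_le hx ?_
  calc a∗ * x * a = a∗ * (x * a) := mul_assoc ..
    _ ≤ a∗ * (a * x + x) := by grw [h]
    _ = a∗ * a * x + a∗ * x := by rw [mul_add, mul_assoc]
    _ ≤ a∗ * x := add_le (by grw [kstar_mul_le_kstar]) le_rfl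

theorem kstar_add_add_le (hba : b * a ≤ a * b) (hcb : c * b ≤ b * c)
    (hca : c * a ≤ a * c + b) : (a + b + c)∗ ≤ a∗ * b∗ * c∗ := by
  have past_a : (b + c) * a∗ ≤ a∗ * (b + c) := mul_kstar_le_kstar_mul <| calc
    (b + c) * a ≤ a * b + (a * c + b) := by grw [add_mul, hba, hca]
    _ = a * (b + c) + b := by rw [mul_add, add_assoc]
    _ ≤ a * (b + c) + (b + c) := by gcongr; exact le_self_add
  have past_b : (b + c) * b∗ ≤ b∗ * (b + c) := mul_kstar_le_kstar_mul <| calc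
    (b + c) * b ≤ b * (b + c) := by grw [add_mul, hcb, mul_add]
    _ ≤ b * (b + c) + (b + c) := le_self_add
  refine kstar_le_of_mul_le_right ?_ ?_
  · grw [← one_le_kstar, ← one_le_kstar, ← one_le_kstar]
    simp only [mul_one, le_refl]
  · rw [add_assoc, add_mul]
    refine add_le (by grw [← mul_assoc, ← mul_assoc, mul_kstar_le_kstar]) ?_
    calc (b + c) * (a∗ * b∗ * c∗) = (b + c) * a∗ * b∗ * c∗ := by simp only [mul_assoc]
      _ ≤ a∗ * ((b + c) * b∗) * c∗ := by grw [past_a, mul_assoc a∗]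
      _ ≤ a∗ * (b∗ * (b + c)) * c∗ := by grw [past_b]
      _ = a∗ * (b∗ * b) * c∗ + a∗ * b∗ * (c * c∗) := by simp only [mul_add, add_mul, mul_assoc]
      _ ≤ a∗ * b∗ * c∗ := by grw [kstar_mul_le_kstar, mul_kstar_le_kstar, add_idem]

end KleeneAlgebra

section SpanStar

variable {R A : Type*} [CommSemiring R] [Semiring A] [Algebra R A]

/-- The submodules of an algebra form a Kleene algebra: the star of `S` is the subalgebra
generated by `S`. -/
instance : KleeneAlgebra (Submodule R A) where
  kstar S := (Algebra.adjoin R (S : Set A)).toSubmodule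
  one_le_kstar S := Submodule.one_le.2 (one_mem (Algebra.adjoin R (S : Set A)))
  mul_kstar_le_kstar S := Submodule.mul_le.2 fun _ hx _ hy =>
    mul_mem (S := Subalgebra R A) (Algebra.subset_adjoin hx) hy
  kstar_mul_le_kstar S := Submodule.mul_le.2 fun _ hx _ hy =>
    mul_mem (S := Subalgebra R A) hx (Algebra.subset_adjoin hy)
  mul_kstar_le_self S T hTS := by
    refine Submodule.mul_le.2 fun y hy x hx => ?_
    induction hx using Algebra.adjoin_induction generalizing y with
    | mem x hx => exact hTS (Submodule.mul_mem_mul hy hx)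
    | algebraMap r => simpa only [← Algebra.commutes, ← Algebra.smul_def] using T.smul_mem r hy
    | add x₁ x₂ _ _ ih₁ ih₂ => simpa only [mul_add] using T.add_mem (ih₁ y hy) (ih₂ y hy)
    | mul x₁ x₂ _ _ ih₁ ih₂ => simpa only [mul_assoc] using ih₂ _ (ih₁ y hy)
  kstar_mul_le_self S T hST := by
    refine Submodule.mul_le.2 fun x hx y hy => ?_
    induction hx using Algebra.adjoin_induction generalizing y with
    | mem x hx => exact hST (Submodule.mul_mem_mul hx hy)
    | algebraMap r => simpa only [← Algebra.smul_def] using T.smul_mem r hy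
    | add x₁ x₂ _ _ ih₁ ih₂ => simpa only [add_mul] using T.add_mem (ih₁ y hy) (ih₂ y hy)
    | mul x₁ x₂ _ _ ih₁ ih₂ => simpa only [mul_assoc] using ih₁ _ (ih₂ y hy)

theorem kstar_span (S : Set A) : (span R S)∗ = (Algebra.adjoin R S).toSubmodule := by
  change (Algebra.adjoin R (span R S : Set A)).toSubmodule = _
  rw [Algebra.adjoin_span]

theorem span_mul_span_le {S T : Set A} {P : Submodule R A} (h : ∀ x ∈ S, ∀ y ∈ T, x * y ∈ P) :
    span R S * span R T ≤ P := by
  rw [span_mul_span, span_le]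
  exact Set.mul_subset_iff.2 h

theorem kstar_span_le_span_range {ι : Type*} {S : Set A} {g : ι → A}
    (h_one : 1 ∈ span R (Set.range g)) (h_mul : ∀ x ∈ S, ∀ i, x * g i ∈ span R (Set.range g)) :
    (span R S)∗ ≤ span R (Set.range g) :=
  kstar_le_of_mul_le_right (Submodule.one_le.2 h_one)
    (span_mul_span_le fun x hx _ ⟨i, hi⟩ => hi ▸ h_mul x hx i)

theorem kstar_span_singleton_le (x : A) :
    (R ∙ x)∗ ≤ span R (Set.range fun n : ℕ => x ^ n) :=
  kstar_span_le_span_range (subset_span ⟨0, pow_zero x⟩) <| by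
    rintro _ rfl n
    exact subset_span ⟨n + 1, pow_succ' _ n⟩

theorem kstar_span_singleton_le_of_mul_self {x : A} (hx : x * x = 0) :
    (R ∙ x)∗ ≤ span R (Set.range fun n : Fin 2 => x ^ (n : ℕ)) :=
  kstar_span_le_span_range (subset_span ⟨0, pow_zero x⟩) <| by
    rintro _ rfl n
    match n with
    | 0 => exact subset_span ⟨1, by simp⟩
    | 1 => simp [hx]

theorem kstar_span_units_le {k l : Aˣ} (h : Commute k l) :
    (span R {(k : A), ↑k⁻¹, ↑l, ↑l⁻¹})∗ ≤
      span R (Set.range fun z : ℤ × ℤ => (↑(k ^ z.1) * ↑(l ^ z.2) : A)) := by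
  have mul_mem (u : Aˣ) (m n : ℤ) (hu : u = k ^ m * l ^ n) (z : ℤ × ℤ) :
      (u * (↑(k ^ z.1) * ↑(l ^ z.2)) : A) ∈
        span R (Set.range fun z : ℤ × ℤ => (↑(k ^ z.1) * ↑(l ^ z.2) : A)) := by
    refine subset_span ⟨(m + z.1, n + z.2), ?_⟩
    simp only [← Units.val_mul]
    rw [hu, zpow_add, zpow_add, mul_assoc, mul_assoc, (h.zpow_zpow z.1 n).left_comm]
  refine kstar_span_le_span_range (subset_span ⟨0, by simp⟩) ?_
  rintro _ (rfl | rfl | rfl | rfl)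
  · exact mul_mem _ 1 0 (by simp)
  · exact mul_mem _ (-1) 0 (by simp)
  · exact mul_mem _ 0 1 (by simp)
  · exact mul_mem _ 0 (-1) (by simp)

theorem mul_le_span_range {ι κ : Type*} {S T : Submodule R A} {g : ι → A} {h : κ → A}
    (hS : S ≤ span R (Set.range g)) (hT : T ≤ span R (Set.range h)) :
    S * T ≤ span R (Set.range fun p : ι × κ => g p.1 * h p.2) := by
  grw [hS, hT]
  refine span_mul_span_le ?_
  rintro _ ⟨i, rfl⟩ _ ⟨j, rfl⟩
  exact subset_span ⟨(i, j), rfl⟩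

theorem kstar_mul_kstar_mul_kstar_le {x y z : A} (hz : z * z = 0) (hy : y * y = 0) :
    (R ∙ x)∗ * (R ∙ z)∗ * (R ∙ y)∗ ≤
      span R (Set.range fun p : (ℕ × Fin 2) × Fin 2 =>
        x ^ p.1.1 * z ^ (p.1.2 : ℕ) * y ^ (p.2 : ℕ)) := by
  apply mul_le_span_range (mul_le_span_range (kstar_span_singleton_le x)
    (kstar_span_singleton_le_of_mul_self hz)) (kstar_span_singleton_le_of_mul_self hy)

end SpanStar

section SkewCommute

variable {F A : Type*} [Field F] [Ring A] [Algebra F A]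

theorem mul_inv_eq_smul {c : F} {x : A} {k : Aˣ} (h : x * k = c • (k * x)) :
    x * ↑k⁻¹ = c⁻¹ • (↑k⁻¹ * x) := by
  obtain rfl | hc := eq_or_ne c 0
  · have : x = 0 := by simpa only [zero_smul, Units.mul_left_eq_zero] using h
    simp [this]
  · rw [Units.mul_inv_eq_iff_eq_mul, smul_mul_assoc, mul_assoc, h, mul_smul_comm,
      inv_smul_smul₀ hc, Units.inv_mul_cancel_left]

/-- `x` and `y` commute up to a scalar factor. -/
def SkewCommute (F : Type*) {A : Type*} [Field F] [Ring A] [Algebra F A] (x y : A) : Prop :=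
  ∃ c : F, x * y = c • (y * x)

namespace SkewCommute

theorem of_commute {x y : A} (h : x * y = y * x) : SkewCommute F x y := ⟨1, by rw [one_smul, h]⟩

theorem inv_right {x : A} {k : Aˣ} : SkewCommute F x k → SkewCommute F x ↑k⁻¹ :=
  fun ⟨c, h⟩ => ⟨c⁻¹, mul_inv_eq_smul h⟩

theorem inv_left {k : Aˣ} {y : A} : SkewCommute F ↑k y → SkewCommute F ↑k⁻¹ y := by
  rintro ⟨c, h⟩
  refine ⟨c⁻¹, ?_⟩
  obtain rfl | hc := eq_or_ne c 0
  · have : y = 0 := by simpa only [zero_smul, Units.mul_right_eq_zero] using h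
    simp [this]
  · rw [Units.inv_mul_eq_iff_eq_mul, mul_smul_comm, ← mul_assoc, h, smul_mul_assoc,
      inv_smul_smul₀ hc, Units.mul_inv_cancel_right]

theorem mem_span_mul_span {S T : Set A} {x y : A} (h : SkewCommute F x y) (hx : x ∈ S)
    (hy : y ∈ T) : x * y ∈ span F T * span F S := by
  obtain ⟨c, h⟩ := h
  exact h ▸ smul_mem _ c (mul_mem_mul (subset_span hy) (subset_span hx))

theorem span_mul_span_le {S T : Set A} (h : ∀ x ∈ S, ∀ y ∈ T, SkewCommute F x y) :
    span F S * span F T ≤ span F T * span F S :=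
  QuantumSl21.span_mul_span_le fun x hx y hy => (h x hx y hy).mem_span_mul_span hx hy

end SkewCommute

end SkewCommute

section QCommutator

variable {F A : Type*} [Field F] [Ring A] [Algebra F A]

/-- The `q`-commutator `x y - q y x`, so that `f₃ = [f₂, f₁]_q` and `e₃ = [e₁, e₂]_{q⁻¹}`. -/
def qCommutator (q : F) (x y : A) : A := x * y - q • (y * x)

/-- The element whose vanishing is the cubic `q`-Serre relation between `x` and `y`. -/
def qSerre (q : F) (x y : A) : A := x ^ 2 * y - (q + q⁻¹) • (x * y * x) + y * x ^ 2

theorem qCommutator_inv_swap {q : F} (hq : q ≠ 0) (x y : A) :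
    qCommutator q⁻¹ x y = (-q⁻¹) • qCommutator q y x := by
  simp only [qCommutator, smul_sub, neg_smul, inv_smul_smul₀ hq, sub_neg_eq_add, neg_add_eq_sub]

variable {q : F} {x y : A}

theorem qCommutator_mul_of_serre (hq : q ≠ 0) (serre : qSerre q x y = 0) :
    qCommutator q y x * x = q⁻¹ • (x * qCommutator q y x) := by
  rw [← sub_eq_zero, ← serre]
  simp only [qSerre, qCommutator, sub_mul, mul_sub, smul_mul_assoc, mul_smul_comm, smul_sub,
    pow_two, mul_assoc, inv_smul_smul₀ hq, add_smul]
  abel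

theorem mul_qCommutator_of_mul_self (hy : y * y = 0) :
    y * qCommutator q y x = (-q) • (qCommutator q y x * y) := by
  simp only [qCommutator, mul_sub, sub_mul, mul_smul_comm, smul_mul_assoc, mul_assoc, hy,
    ← mul_assoc y y, zero_mul, mul_zero, smul_zero, zero_sub, sub_zero, neg_smul]

theorem qCommutator_mul_self (hq : q ≠ 0) (hq2 : q ^ 2 ≠ -1) (serre : qSerre q x y = 0)
    (hy : y * y = 0) :
    qCommutator q y x * qCommutator q y x = 0 := by
  have hxz : x * qCommutator q y x = q • (qCommutator q y x * x) := by
    rw [qCommutator_mul_of_serre hq serre, smul_inv_smul₀ hq]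
  have hyz := mul_qCommutator_of_mul_self (q := q) (x := x) hy
  generalize hz : qCommutator q y x = z at *
  have key : z * z = (-q ^ 2) • (z * z) := calc
    z * z = qCommutator q y x * z := by rw [hz]
    _ = y * (x * z) - q • (x * (y * z)) := by
      rw [qCommutator, sub_mul, smul_mul_assoc, mul_assoc, mul_assoc]
    _ = (-q ^ 2) • (z * (y * x)) + q ^ 3 • (z * (x * y)) := by
      simp only [hxz, hyz, mul_smul_comm, ← mul_assoc, smul_mul_assoc]
      module
    _ = (-q ^ 2) • (z * qCommutator q y x) := by
      simp only [qCommutator, mul_sub, mul_smul_comm]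
      module
    _ = (-q ^ 2) • (z * z) := by rw [hz]
  have : (q ^ 2 + 1) • (z * z) = 0 := by linear_combination (norm := module) key
  exact (smul_eq_zero.1 this).resolve_left fun h => hq2 (eq_neg_of_add_eq_zero_left h)

theorem kstar_span_pair_le_of_serre (hq : q ≠ 0) (serre : qSerre q x y = 0)
    (hy : y * y = 0) :
    (span F {x, y})∗ ≤ (F ∙ x)∗ * (F ∙ qCommutator q y x)∗ * (F ∙ y)∗ := by
  have hzx : SkewCommute F (qCommutator q y x) x := ⟨_, qCommutator_mul_of_serre hq serre⟩
  have hyz : SkewCommute F y (qCommutator q y x) := ⟨_, mul_qCommutator_of_mul_self hy⟩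
  have hyx : y * x = q • (x * y) + qCommutator q y x := by rw [qCommutator]; abel
  have h_le : span F {x, y} ≤ (F ∙ x) + (F ∙ qCommutator q y x) + (F ∙ y) := by
    rw [span_insert]
    exact sup_le (le_add_right le_self_add) le_add_self
  grw [h_le]
  refine kstar_add_add_le ?_ ?_ (span_mul_span_le ?_)
  · exact SkewCommute.span_mul_span_le fun _ hz _ hx => hz ▸ hx ▸ hzx
  · exact SkewCommute.span_mul_span_le fun _ hy _ hz => hy ▸ hz ▸ hyz
  · rintro _ rfl _ rfl
    rw [hyx]
    exact add_mem_sup (smul_mem _ q (mul_mem_mul (mem_span_singleton_self _)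
      (mem_span_singleton_self _))) (mem_span_singleton_self _)

end QCommutator

namespace Uq

variable {F : Type*} [Field F] (q : F)

theorem k₂_mul_k₁ : (k₂ q : Uq F q) * k₁ q = k₁ q * k₂ q := by
  simpa only [k₁, k₂, map_mul] using proj_eq_of_rel q .k₂_k₁

theorem e₁_mul_k₁ : e₁ q * k₁ q = q⁻¹ ^ 2 • (k₁ q * e₁ q) := by
  simpa only [e₁, k₁, map_mul, map_smul] using proj_eq_of_rel q .e₁_k₁

theorem e₂_mul_k₁ : e₂ q * k₁ q = q • (k₁ q * e₂ q) := by
  simpa only [e₂, k₁, map_mul, map_smul] using proj_eq_of_rel q .e₂_k₁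

theorem e₁_mul_k₂ : e₁ q * k₂ q = q • (k₂ q * e₁ q) := by
  simpa only [e₁, k₂, map_mul, map_smul] using proj_eq_of_rel q .e₁_k₂

theorem e₂_mul_k₂ : e₂ q * k₂ q = k₂ q * e₂ q := by
  simpa only [e₂, k₂, map_mul] using proj_eq_of_rel q .e₂_k₂

theorem k₁_mul_f₁ : k₁ q * f₁ q = q⁻¹ ^ 2 • (f₁ q * k₁ q) := by
  simpa only [f₁, k₁, map_mul, map_smul] using proj_eq_of_rel q .k₁_f₁

theorem k₁_mul_f₂ : k₁ q * f₂ q = q • (f₂ q * k₁ q) := by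
  simpa only [f₂, k₁, map_mul, map_smul] using proj_eq_of_rel q .k₁_f₂

theorem k₂_mul_f₁ : k₂ q * f₁ q = q • (f₁ q * k₂ q) := by
  simpa only [f₁, k₂, map_mul, map_smul] using proj_eq_of_rel q .k₂_f₁

theorem k₂_mul_f₂ : k₂ q * f₂ q = f₂ q * k₂ q := by
  simpa only [f₂, k₂, map_mul] using proj_eq_of_rel q .k₂_f₂

theorem e₁_mul_f₁ :
    e₁ q * f₁ q = f₁ q * e₁ q + (q - q⁻¹)⁻¹ • ((k₁ q : Uq F q) - ↑(k₁ q)⁻¹) := by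
  simpa only [e₁, f₁, k₁, Units.inv_mk, map_mul, map_add, map_smul, map_sub]
    using proj_eq_of_rel q .e₁_f₁

theorem e₂_mul_f₂ :
    e₂ q * f₂ q = -(f₂ q * e₂ q) + (q - q⁻¹)⁻¹ • ((k₂ q : Uq F q) - ↑(k₂ q)⁻¹) := by
  simpa only [e₂, f₂, k₂, Units.inv_mk, map_mul, map_add, map_neg, map_smul, map_sub]
    using proj_eq_of_rel q .e₂_f₂

theorem e₁_mul_f₂ : e₁ q * f₂ q = f₂ q * e₁ q := by
  simpa only [e₁, f₂, map_mul] using proj_eq_of_rel q .e₁_f₂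

theorem e₂_mul_f₁ : e₂ q * f₁ q = f₁ q * e₂ q := by
  simpa only [e₂, f₁, map_mul] using proj_eq_of_rel q .e₂_f₁

theorem e₂_mul_self : e₂ q * e₂ q = 0 := by
  simpa only [e₂, map_mul, map_zero, pow_two] using proj_eq_of_rel q .e₂_sq

theorem f₂_mul_self : f₂ q * f₂ q = 0 := by
  simpa only [f₂, map_mul, map_zero, pow_two] using proj_eq_of_rel q .f₂_sq

theorem e_serre : qSerre q (e₁ q) (e₂ q) = 0 := by
  simpa only [qSerre, e₁, e₂, map_mul, map_zero, map_pow, map_add, map_sub, map_smul]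
    using proj_eq_of_rel q .e_serre

theorem f_serre : qSerre q (f₁ q) (f₂ q) = 0 := by
  simpa only [qSerre, f₁, f₂, map_mul, map_zero, map_pow, map_add, map_sub, map_smul]
    using proj_eq_of_rel q .f_serre

/-- The lowering generators. -/
abbrev fGens : Set (Uq F q) := {f₁ q, f₂ q}

/-- The generators of the torus. -/
abbrev kGens : Set (Uq F q) := {↑(k₁ q), ↑(k₁ q)⁻¹, ↑(k₂ q), ↑(k₂ q)⁻¹}

/-- The raising generators. -/
abbrev eGens : Set (Uq F q) := {e₁ q, e₂ q}

theorem kstar_span_gens_eq_top :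
    (span F (fGens q) + span F (kGens q) + span F (eGens q))∗ = ⊤ := by
  have adjoin_eq_top : Algebra.adjoin F (Set.range (proj q ∘ FreeAlgebra.ι F)) = ⊤ := by
    rw [Set.range_comp, ← AlgHom.map_adjoin, FreeAlgebra.adjoin_range_ι, Algebra.map_top,
      AlgHom.range_eq_top]
    exact RingQuot.mkAlgHom_surjective F _
  rw [Submodule.add_eq_sup, Submodule.add_eq_sup, ← span_union, ← span_union, kstar_span,
    Algebra.toSubmodule_eq_top, eq_top_iff, ← adjoin_eq_top]
  refine Algebra.adjoin_mono ?_
  rintro _ ⟨x, rfl⟩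
  cases x
  case k₁ => exact .inl (.inr (.inl rfl))
  case k₁inv => exact .inl (.inr (.inr (.inl rfl)))
  case k₂ => exact .inl (.inr (.inr (.inr (.inl rfl))))
  case k₂inv => exact .inl (.inr (.inr (.inr (.inr rfl))))
  case e₁ => exact .inr (.inl rfl)
  case e₂ => exact .inr (.inr rfl)
  case f₁ => exact .inl (.inl (.inl rfl))
  case f₂ => exact .inl (.inl (.inr rfl))

theorem skewCommute_kGens_fGens : ∀ k ∈ kGens q, ∀ f ∈ fGens q, SkewCommute F k f := by
  rintro _ (rfl | rfl | rfl | rfl) _ (rfl | rfl)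
  exacts [⟨_, k₁_mul_f₁ q⟩, ⟨_, k₁_mul_f₂ q⟩, .inv_left ⟨_, k₁_mul_f₁ q⟩,
    .inv_left ⟨_, k₁_mul_f₂ q⟩, ⟨_, k₂_mul_f₁ q⟩, .of_commute (k₂_mul_f₂ q),
    .inv_left ⟨_, k₂_mul_f₁ q⟩, .inv_left (.of_commute (k₂_mul_f₂ q))]

theorem skewCommute_eGens_kGens : ∀ e ∈ eGens q, ∀ k ∈ kGens q, SkewCommute F e k := by
  rintro _ (rfl | rfl) _ (rfl | rfl | rfl | rfl)
  exacts [⟨_, e₁_mul_k₁ q⟩, .inv_right ⟨_, e₁_mul_k₁ q⟩, ⟨_, e₁_mul_k₂ q⟩,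
    .inv_right ⟨_, e₁_mul_k₂ q⟩, ⟨_, e₂_mul_k₁ q⟩, .inv_right ⟨_, e₂_mul_k₁ q⟩,
    .of_commute (e₂_mul_k₂ q), .inv_right (.of_commute (e₂_mul_k₂ q))]

theorem span_eGens_mul_span_fGens_le :
    span F (eGens q) * span F (fGens q) ≤
      span F (fGens q) * span F (eGens q) + span F (kGens q) := by
  have mul_mem {f e : Uq F q} (hf : f ∈ fGens q) (he : e ∈ eGens q) :
      f * e ∈ span F (fGens q) * span F (eGens q) := mul_mem_mul (subset_span hf) (subset_span he)
  have sub_inv_mem {k : (Uq F q)ˣ} (hk : (k : Uq F q) ∈ kGens q) (hk' : ↑k⁻¹ ∈ kGens q) :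
      (q - q⁻¹)⁻¹ • ((k : Uq F q) - ↑k⁻¹) ∈ span F (kGens q) :=
    smul_mem _ _ (sub_mem (subset_span hk) (subset_span hk'))
  refine span_mul_span_le ?_
  rintro _ (rfl | rfl) _ (rfl | rfl)
  · rw [e₁_mul_f₁]
    exact add_mem_sup (mul_mem (by simp) (by simp)) (sub_inv_mem (by simp) (by simp))
  · rw [e₁_mul_f₂]
    exact mem_sup_left (mul_mem (by simp) (by simp))
  · rw [e₂_mul_f₁]
    exact mem_sup_left (mul_mem (by simp) (by simp))
  · rw [e₂_mul_f₂]
    exact add_mem_sup (neg_mem (mul_mem (by simp) (by simp))) (sub_inv_mem (by simp) (by simp))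

theorem top_le_kstar_mul_kstar_mul_kstar :
    ⊤ ≤ (span F (fGens q))∗ * (span F (kGens q))∗ * (span F (eGens q))∗ := by
  rw [← kstar_span_gens_eq_top]
  exact kstar_add_add_le (SkewCommute.span_mul_span_le (skewCommute_kGens_fGens q))
    (SkewCommute.span_mul_span_le (skewCommute_eGens_kGens q)) (span_eGens_mul_span_fGens_le q)

variable {q}

theorem e₃_eq_smul (hq : q ≠ 0) : e₃ q = (-q⁻¹) • qCommutator q (e₂ q) (e₁ q) :=
  qCommutator_inv_swap hq _ _

theorem f₃_mul_self (hq : q ≠ 0) (hq2 : q ^ 2 ≠ -1) : f₃ q * f₃ q = 0 :=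
  qCommutator_mul_self hq hq2 (f_serre q) (f₂_mul_self q)

theorem e₃_mul_self (hq : q ≠ 0) (hq2 : q ^ 2 ≠ -1) : e₃ q * e₃ q = 0 := by
  rw [e₃_eq_smul hq, smul_mul_smul_comm,
    qCommutator_mul_self hq hq2 (e_serre q) (e₂_mul_self q), smul_zero]

theorem kstar_span_fGens_le (hq : q ≠ 0) :
    (span F (fGens q))∗ ≤ (F ∙ f₁ q)∗ * (F ∙ f₃ q)∗ * (F ∙ f₂ q)∗ :=
  kstar_span_pair_le_of_serre hq (f_serre q) (f₂_mul_self q)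

theorem kstar_span_eGens_le (hq : q ≠ 0) :
    (span F (eGens q))∗ ≤ (F ∙ e₁ q)∗ * (F ∙ e₃ q)∗ * (F ∙ e₂ q)∗ := by
  rw [e₃_eq_smul hq, span_singleton_smul_eq (neg_ne_zero.2 (inv_ne_zero hq)).isUnit]
  exact kstar_span_pair_le_of_serre hq (e_serre q) (e₂_mul_self q)

theorem span_range_monomial (hq : q ≠ 0) (hq2 : q ^ 2 ≠ -1) :
    span F (Set.range (monomial q)) = ⊤ := by
  refine top_le_iff.1 ((top_le_kstar_mul_kstar_mul_kstar q).trans ?_)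
  have f_le := (kstar_span_fGens_le hq).trans
    (kstar_mul_kstar_mul_kstar_le (f₃_mul_self hq hq2) (f₂_mul_self q))
  have k_le := kstar_span_units_le (R := F) (Units.ext (k₂_mul_k₁ q).symm)
  have e_le := (kstar_span_eGens_le hq).trans
    (kstar_mul_kstar_mul_kstar_le (e₃_mul_self hq hq2) (e₂_mul_self q))
  refine (mul_le_span_range (mul_le_span_range f_le k_le) e_le).trans ?_
  refine span_mono ?_
  rintro _ ⟨⟨⟨⟨⟨w, s⟩, l⟩, i, j⟩, ⟨r, h⟩, t⟩, rfl⟩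
  exact ⟨(w, s, l, i, j, r, h, t), by simp only [monomial, mul_assoc]⟩

end Uq

end Spanning

section SkewRelations

variable {F A : Type*} [Field F] [Ring A] [Algebra F A]

theorem mul_left_comm_of_eq_smul {r : F} {x y : A} (h : x * y = r • (y * x)) (z : A) :
    x * (y * z) = r • (y * (x * z)) := by
  rw [← mul_assoc, h, smul_mul_assoc, mul_assoc]

theorem skew_defect_mul {e k f d : A} {a c ε : F} (hkf : k * f = a • (f * k))
    (hef : e * f = ε • (f * e) + d) (hd : a • (d * k) = c • (k * d)) :
    (e * k - c • (k * e)) * f = (ε * a) • (f * (e * k - c • (k * e))) := by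
  linear_combination (norm := skip)
    e * hkf + a • (hef * k) - c • (k * hef) - (c * ε) • (hkf * e) + hd
  simp only [mul_add, mul_sub, add_mul, sub_mul, smul_mul_assoc, mul_smul_comm, smul_add,
    smul_sub, mul_assoc]
  module

theorem skewCommute_defect {e k f d : A} {c ε : F} (hkf : k * f = c • (f * k))
    (hef : e * f = ε • (f * e) + d) (hd : Commute d k) :
    SkewCommute F (e * k - c • (k * e)) f :=
  ⟨_, skew_defect_mul hkf hef (by rw [hd.eq])⟩

theorem skewCommute_defect_of_commute {e k f : A} {a : F} (c : F) (hkf : k * f = a • (f * k))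
    (hef : e * f = f * e) : SkewCommute F (e * k - c • (k * e)) f :=
  ⟨_, skew_defect_mul (ε := 1) (d := 0) hkf (by rw [hef, one_smul, add_zero])
    (by rw [zero_mul, mul_zero, smul_zero, smul_zero])⟩

theorem commute_smul_sub_inv {a : A} {k : Aˣ} (h : Commute a k) (c : F) :
    Commute (c • ((k : A) - ↑k⁻¹)) a :=
  ((h.sub_right h.units_inv_right).smul_right c).symm

theorem mul_self_commute_of_mul_eq_neg_add {e f d : A} (hef : e * f = -(f * e) + d)
    (hed : Commute e d) : Commute (e * e) f := by
  rw [Commute, SemiconjBy, mul_assoc, hef, mul_add, mul_neg, ← mul_assoc, hef, hed.eq, add_mul,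
    neg_mul, mul_assoc]
  abel

variable {q c : F} {x y f : A} {k : Aˣ}

theorem qSerre_mul_of_left (hq : q ≠ 0) (hxf : x * f = f * x + c • ((k : A) - ↑k⁻¹))
    (hyf : y * f = f * y) (hxk : x * k = q⁻¹ ^ 2 • (k * x)) (hyk : y * k = q • (k * y)) :
    qSerre q x y * f = f * qSerre q x y := by
  have hxf' (z : A) : x * (f * z) = f * (x * z) + c • (k * z - ↑k⁻¹ * z) := by
    rw [← mul_assoc, hxf, add_mul, smul_mul_assoc, sub_mul, mul_assoc]
  have hyf' (z : A) : y * (f * z) = f * (y * z) := by rw [← mul_assoc, hyf, mul_assoc]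
  simp only [qSerre, pow_two, mul_assoc, add_mul, sub_mul, mul_add, mul_sub, smul_mul_assoc,
    mul_smul_comm, hxf, hxf', hyf, hyf', hxk, hyk, mul_inv_eq_smul hxk, mul_inv_eq_smul hyk,
    mul_left_comm_of_eq_smul hxk, mul_left_comm_of_eq_smul hyk,
    mul_left_comm_of_eq_smul (mul_inv_eq_smul hxk), mul_left_comm_of_eq_smul (mul_inv_eq_smul hyk)]
  match_scalars <;> field_simp <;> ring

theorem qSerre_mul_of_right (hq : q ≠ 0) (hxf : x * f = f * x)
    (hyf : y * f = -(f * y) + c • ((k : A) - ↑k⁻¹)) (hxk : x * k = q • (k * x)) :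
    qSerre q x y * f = -(f * qSerre q x y) := by
  have hxf' (z : A) : x * (f * z) = f * (x * z) := by rw [← mul_assoc, hxf, mul_assoc]
  have hyf' (z : A) : y * (f * z) = -(f * (y * z)) + c • (k * z - ↑k⁻¹ * z) := by
    rw [← mul_assoc, hyf, add_mul, smul_mul_assoc, sub_mul, neg_mul, mul_assoc]
  simp only [qSerre, pow_two, mul_assoc, add_mul, sub_mul, mul_add, mul_sub, mul_neg,
    smul_mul_assoc, mul_smul_comm, hxf, hxf', hyf, hyf', hxk, mul_inv_eq_smul hxk,
    mul_left_comm_of_eq_smul hxk, mul_left_comm_of_eq_smul (mul_inv_eq_smul hxk)]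
  match_scalars <;> field_simp <;> ring

end SkewRelations

/-! ### The lowering operators on an induced module -/

section DiagOp

variable {F ι W : Type*} [Field F] [AddCommGroup W] [Module F W]

/-- The operator `⨁ᵢ cᵢ T` on `⨁ᵢ W`, linear in `T`. -/
def diagOp (c : ι → F) : End F W →ₗ[F] End F (ι →₀ W) where
  toFun T := Finsupp.lsum F fun i => c i • lsingle i ∘ₗ T
  map_add' S T := by ext; simp
  map_smul' r T := by ext; simp [smul_comm r]

theorem diagOp_single (c : ι → F) (T : End F W) (i : ι) (x : W) :
    diagOp c T (single i x) = c i • single i (T x) := by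
  simp [diagOp]

theorem diagOp_mul_diagOp (c d : ι → F) (S T : End F W) :
    diagOp c S * diagOp d T = diagOp (c * d) (S * T) := by
  ext i x : 2
  simp only [LinearMap.comp_apply, Module.End.mul_apply, Finsupp.lsingle_apply, diagOp_single,
    map_smul, smul_smul, Pi.mul_apply, mul_comm (c i)]

theorem qSerre_diagOp (q : F) (c d : ι → F) (S T : End F W) :
    qSerre q (diagOp c S) (diagOp d T) = diagOp (c ^ 2 * d) (qSerre q S T) := by
  simp only [qSerre, pow_two, diagOp_mul_diagOp, map_add, map_sub, map_smul, mul_right_comm c d c,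
    mul_comm d]

/-- Invertible scalars and an invertible operator give an invertible diagonal operator. -/
def diagUnits : (ι → Fˣ) × (End F W)ˣ →* (End F (ι →₀ W))ˣ :=
  MonoidHom.toHomUnits
    { toFun := fun p => diagOp (fun i => (p.1 i : F)) p.2
      map_one' := by ext; simp [diagOp_single]
      map_mul' := fun p p' => (diagOp_mul_diagOp _ _ _ _).symm }

theorem diagUnits_single (p : (ι → Fˣ) × (End F W)ˣ) (i : ι) (x : W) :
    (diagUnits p : End F (ι →₀ W)) (single i x) = (p.1 i : F) • single i ((p.2 : End F W) x) :=
  diagOp_single _ _ _ _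

end DiagOp

section Shift

variable {F ι W : Type*} [Field F] [AddCommGroup ι] [AddCommGroup W] [Module F W]

variable (F W) in
/-- The translation action of `ι` on `⨁ᵢ W`. -/
def shift : Multiplicative ι →* (End F (ι →₀ W))ˣ :=
  MonoidHom.toHomUnits
    { toFun := fun z => Finsupp.lmapDomain W F (z.toAdd + ·)
      map_one' := by ext; simp
      map_mul' := fun y z => by ext; simp [add_assoc] }

theorem shift_single (z : Multiplicative ι) (i : ι) (x : W) :
    (shift F W z : End F (ι →₀ W)) (single i x) = single (z.toAdd + i) x :=
  Finsupp.mapDomain_single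

theorem shift_zpow_single (z i : ι) (n : ℤ) (x : W) :
    (↑(shift F W (.ofAdd z) ^ n) : End F (ι →₀ W)) (single i x) = single (n • z + i) x := by
  rw [← map_zpow, shift_single, toAdd_zpow, toAdd_ofAdd]

theorem diagOp_mul_shift {c : ι → F} {r : F} {z : Multiplicative ι}
    (h : ∀ i, c (z.toAdd + i) = r * c i) (T : End F W) :
    diagOp c T * shift F W z = r • (shift F W z * diagOp c T : End F (ι →₀ W)) := by
  ext i x : 2
  simp only [LinearMap.comp_apply, Module.End.mul_apply, LinearMap.smul_apply,
    Finsupp.lsingle_apply, diagOp_single, shift_single, map_smul, smul_smul, h]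

end Shift

/-- The tensor product `N⁻ ⊗ W` of the span of the ordered monomials `f₁ʷ f₃ˢ f₂ˡ` with `W`: the
space underlying the `U_q`-module induced from a module `W` over the Borel subalgebra. -/
abbrev Ind (W : Type*) [AddCommGroup W] : Type _ := ℕ × Fin 2 × Fin 2 →₀ W

section Lowering

variable {F W V : Type*} [Field F] [AddCommGroup W] [Module F W] [AddCommGroup V] [Module F V]

/-- The map `x ↦ f₁ʷ f₃ˢ f₂ˡ ⊗ x`. -/
def vec (F : Type*) {W : Type*} [Field F] [AddCommGroup W] [Module F W] (w : ℕ) (s l : Fin 2) :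
    W →ₗ[F] Ind W := lsingle (w, s, l)

theorem vec_apply (w : ℕ) (s l : Fin 2) (x : W) : vec F w s l x = single (w, s, l) x := rfl

namespace Ind

/-- The linear map on `Ind W` with prescribed components. -/
def lift (g : ℕ → Fin 2 → Fin 2 → W →ₗ[F] V) : Ind W →ₗ[F] V :=
  Finsupp.lsum F fun p => g p.1 p.2.1 p.2.2

theorem lift_vec (g : ℕ → Fin 2 → Fin 2 → W →ₗ[F] V) (w : ℕ) (s l : Fin 2) (x : W) :
    lift g (vec F w s l x) = g w s l x := by
  simp [lift, vec_apply]

theorem hom_ext {A B : Ind W →ₗ[F] V}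
    (h : ∀ w s l x, A (vec F w s l x) = B (vec F w s l x)) : A = B :=
  Finsupp.lhom_ext fun p => h p.1 p.2.1 p.2.2

theorem hom_ext' {A B : Ind W →ₗ[F] V}
    (h₀₀ : ∀ w x, A (vec F w 0 0 x) = B (vec F w 0 0 x))
    (h₀₁ : ∀ w x, A (vec F w 0 1 x) = B (vec F w 0 1 x))
    (h₁₀ : ∀ w x, A (vec F w 1 0 x) = B (vec F w 1 0 x))
    (h₁₁ : ∀ w x, A (vec F w 1 1 x) = B (vec F w 1 1 x)) : A = B :=
  hom_ext fun
    | w, 0, 0 => h₀₀ w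
    | w, 0, 1 => h₀₁ w
    | w, 1, 0 => h₁₀ w
    | w, 1, 1 => h₁₁ w

end Ind

/-- The `q`-integer `[n]`. -/
def qInt (q : F) (n : ℕ) : F := (q ^ n - (q ^ n)⁻¹) / (q - q⁻¹)

theorem sub_inv_ne_zero {q : F} (hq : q ≠ 0) (hq2 : q ^ 2 ≠ 1) : q - q⁻¹ ≠ 0 := fun h =>
  hq2 (by rw [pow_two, ← mul_inv_cancel₀ hq, ← sub_eq_zero.1 h])

theorem qInt_zero (q : F) : qInt q 0 = 0 := by rw [qInt, pow_zero, inv_one, sub_self, zero_div]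

theorem qInt_one {q : F} (hq : q ≠ 0) (hq2 : q ^ 2 ≠ 1) : qInt q 1 = 1 := by
  rw [qInt, pow_one, div_self (sub_inv_ne_zero hq hq2)]

namespace Ind

variable (F) in
/-- Left multiplication by `f₁` on `Ind W`. -/
def f₁ : End F (Ind W) := lift fun w s l => vec F (w + 1) s l

/-- Left multiplication by `f₂` on `Ind W`, computed from `f₂ f₁ʷ = qʷ f₁ʷ f₂ + [w] f₁ʷ⁻¹ f₃` and
`f₂ f₃ = -q f₃ f₂`. The truncated `w - 1` is harmless, as `[0] = 0`. -/
def f₂ (q : F) : End F (Ind W) := lift fun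
  | w, 0, 0 => q ^ w • vec F w 0 1 + qInt q w • vec F (w - 1) 1 0
  | w, 0, 1 => qInt q w • vec F (w - 1) 1 1
  | w, 1, 0 => -q ^ (w + 1) • vec F w 1 1
  | _, 1, 1 => 0

section

variable (q : F) (w : ℕ) (s l : Fin 2) (x : W)

theorem f₁_vec : f₁ F (vec F w s l x) = vec F (w + 1) s l x := lift_vec ..

theorem f₂_vec_zero_zero :
    f₂ q (vec F w 0 0 x) = q ^ w • vec F w 0 1 x + qInt q w • vec F (w - 1) 1 0 x := lift_vec ..

theorem f₂_vec_zero_one : f₂ q (vec F w 0 1 x) = qInt q w • vec F (w - 1) 1 1 x := lift_vec ..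

theorem f₂_vec_one_zero : f₂ q (vec F w 1 0 x) = -q ^ (w + 1) • vec F w 1 1 x := lift_vec ..

theorem f₂_vec_one_one : f₂ q (vec F w 1 1 x) = 0 := lift_vec ..

end

variable {q : F}

theorem f₂_mul_self : f₂ q * f₂ q = (0 : End F (Ind W)) := by
  refine hom_ext' ?_ ?_ ?_ ?_ <;> rintro (_ | w) x <;>
    simp only [Module.End.mul_apply, LinearMap.zero_apply, f₂_vec_zero_zero, f₂_vec_zero_one,
      f₂_vec_one_zero, f₂_vec_one_one, map_add, map_smul, map_zero, smul_zero, qInt_zero,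
      zero_smul, add_zero, Nat.add_sub_cancel]
  module

theorem f_serre (hq : q ≠ 0) (hq2 : q ^ 2 ≠ 1) :
    qSerre q (f₁ F) (f₂ q) = (0 : End F (Ind W)) := by
  have := sub_ne_zero.2 hq2
  refine hom_ext' ?_ ?_ ?_ ?_ <;> rintro (_ | w) x <;>
    simp only [qSerre, Module.End.mul_apply, LinearMap.zero_apply, LinearMap.add_apply,
      LinearMap.sub_apply, LinearMap.smul_apply, pow_two, f₁_vec, f₂_vec_zero_zero, f₂_vec_zero_one,
      f₂_vec_one_zero, f₂_vec_one_one, map_add, map_smul, map_zero, qInt_zero, zero_smul, add_zero,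
      Nat.add_sub_cancel] <;>
    match_scalars <;> (try simp only [qInt]) <;> field_simp <;> ring

theorem qCommutator_vec (hq : q ≠ 0) (hq2 : q ^ 2 ≠ 1) (l : Fin 2) (x : W) :
    qCommutator q (f₂ q) (f₁ F) (vec F 0 0 l x) = vec F 0 1 l x := by
  match l with
  | 0 =>
    simp only [qCommutator, LinearMap.sub_apply, LinearMap.smul_apply, Module.End.mul_apply,
      f₁_vec, f₂_vec_zero_zero, map_add, map_smul, qInt_zero, zero_add, qInt_one hq hq2]
    module
  | 1 =>
    simp only [qCommutator, LinearMap.sub_apply, LinearMap.smul_apply, Module.End.mul_apply,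
      f₁_vec, f₂_vec_zero_one, map_smul, qInt_zero, zero_add, qInt_one hq hq2]
    module

theorem f₁_pow_vec (w : ℕ) (s l : Fin 2) (x : W) : (f₁ F ^ w) (vec F 0 s l x) = vec F w s l x := by
  induction w with
  | zero => rfl
  | succ w ih => rw [pow_succ', Module.End.mul_apply, ih, f₁_vec]

theorem ordered_monomial_vec (hq : q ≠ 0) (hq2 : q ^ 2 ≠ 1) (w : ℕ) (s l : Fin 2) (x : W) :
    (f₁ F ^ w * qCommutator q (f₂ q) (f₁ F) ^ (s : ℕ) * f₂ q ^ (l : ℕ) : End F (Ind W))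
      (vec F 0 0 0 x) = vec F w s l x := by
  have f₂_pow : (f₂ q ^ (l : ℕ)) (vec F 0 0 0 x) = vec F 0 0 l x := by
    match l with
    | 0 => rfl
    | 1 => simp [f₂_vec_zero_zero, qInt_zero]
  have f₃_pow : (qCommutator q (f₂ q) (f₁ F) ^ (s : ℕ)) (vec F 0 0 l x) = vec F 0 s l x := by
    match s with
    | 0 => rfl
    | 1 => simp [qCommutator_vec hq hq2]
  rw [Module.End.mul_apply, Module.End.mul_apply, f₂_pow, f₃_pow, f₁_pow_vec]

/-- `f₁` and `f₂` generate `Ind W` from its top component `1 ⊗ W`. -/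
theorem eq_zero_of_skewCommute (hq : q ≠ 0) (hq2 : q ^ 2 ≠ 1) {X : End F (Ind W)}
    (h₀ : ∀ x, X (vec F 0 0 0 x) = 0) (h₁ : SkewCommute F X (f₁ F))
    (h₂ : SkewCommute F X (f₂ q)) : X = 0 := by
  have apply_eq_zero {T : End F (Ind W)} (hT : SkewCommute F X T) {v} (hv : X v = 0) :
      X (T v) = 0 := by
    obtain ⟨c, hc⟩ := hT
    rw [← Module.End.mul_apply, hc, LinearMap.smul_apply, Module.End.mul_apply, hv, map_zero,
      smul_zero]
  have apply_f₃_eq_zero {v} (hv : X v = 0) : X (qCommutator q (f₂ q) (f₁ F) v) = 0 := by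
    simp only [qCommutator, LinearMap.sub_apply, LinearMap.smul_apply, Module.End.mul_apply,
      map_sub, map_smul, apply_eq_zero h₁ (apply_eq_zero h₂ hv),
      apply_eq_zero h₂ (apply_eq_zero h₁ hv), smul_zero, sub_zero]
  have pow_apply_eq_zero {T : End F (Ind W)} (hT : ∀ {v}, X v = 0 → X (T v) = 0) (n : ℕ) {v}
      (hv : X v = 0) : X ((T ^ n) v) = 0 := by
    induction n with
    | zero => exact hv
    | succ n ih => rw [pow_succ', Module.End.mul_apply, hT ih]
  refine hom_ext fun w s l x => ?_
  rw [← ordered_monomial_vec hq hq2 w s l x]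
  exact pow_apply_eq_zero (apply_eq_zero h₁) w (pow_apply_eq_zero apply_f₃_eq_zero s
    (pow_apply_eq_zero (apply_eq_zero h₂) l (h₀ x)))

end Ind

end Lowering

/-! ### The torus and the raising operators on an induced module -/

namespace Ind

variable {F W : Type*} [Field F] [AddCommGroup W] [Module F W]

/-- The action of a toral element `k` on `Ind W`, given its action `u` on `W` and the scalars
`α`, `β` for which `k f₁ = α f₁ k` and `k f₂ = β f₂ k`. -/
def torus (α β : Fˣ) (u : (End F W)ˣ) : (End F (Ind W))ˣ :=
  diagUnits (fun p => α ^ p.1 * (α * β) ^ (p.2.1 : ℕ) * β ^ (p.2.2 : ℕ), u)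

section Torus

variable (α β : Fˣ) (u : (End F W)ˣ)

theorem torus_vec (w : ℕ) (s l : Fin 2) (x : W) :
    (torus α β u : End F (Ind W)) (vec F w s l x) =
      (α ^ w * (α * β) ^ (s : ℕ) * β ^ (l : ℕ) : F) • vec F w s l ((u : End F W) x) := by
  simp only [torus, vec_apply, diagUnits_single, Units.val_mul, Units.val_pow_eq_pow_val]

theorem torus_inv : (torus α β u)⁻¹ = torus α⁻¹ β⁻¹ u⁻¹ := by
  have inv_eq : (fun p : ℕ × Fin 2 × Fin 2 => α ^ p.1 * (α * β) ^ (p.2.1 : ℕ) * β ^ (p.2.2 : ℕ))⁻¹ =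
      fun p => α⁻¹ ^ p.1 * (α⁻¹ * β⁻¹) ^ (p.2.1 : ℕ) * β⁻¹ ^ (p.2.2 : ℕ) := by
    ext1 p
    simp only [Pi.inv_apply, mul_inv, inv_pow, mul_pow]
  rw [torus, torus, ← map_inv, Prod.inv_mk, inv_eq]

theorem torus_zpow_vec_zero (n : ℤ) (x : W) :
    (↑(torus α β u ^ n) : End F (Ind W)) (vec F 0 0 0 x) =
      vec F 0 0 0 ((↑(u ^ n) : End F W) x) := by
  rw [torus, ← map_zpow, vec_apply, diagUnits_single]
  simp only [Prod.pow_mk, Pi.pow_apply, Fin.val_zero, pow_zero, mul_one, one_zpow, Units.val_one,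
    one_smul, vec_apply]

variable {u} in
theorem torus_commute {v : (End F W)ˣ} (h : Commute u v) (γ δ : Fˣ) :
    Commute (torus α β u) (torus γ δ v) := by
  rw [Commute, SemiconjBy, torus, torus, ← map_mul, ← map_mul, Prod.mk_mul_mk, Prod.mk_mul_mk,
    h.eq, mul_comm (fun _ => _)]

theorem torus_mul_f₁ :
    (torus α β u : End F (Ind W)) * f₁ F = (α : F) • (f₁ F * (torus α β u : End F (Ind W))) := by
  refine hom_ext fun w s l x => ?_
  simp only [Module.End.mul_apply, LinearMap.smul_apply, f₁_vec, torus_vec, map_smul]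
  module

theorem torus_mul_f₂ (q : F) :
    (torus α β u : End F (Ind W)) * f₂ q = (β : F) • (f₂ q * (torus α β u : End F (Ind W))) := by
  refine hom_ext' ?_ ?_ ?_ ?_ <;> rintro (_ | w) x <;>
    simp only [Module.End.mul_apply, LinearMap.smul_apply, f₂_vec_zero_zero, f₂_vec_zero_one,
      f₂_vec_one_zero, f₂_vec_one_one, torus_vec, map_add, map_smul, map_zero, smul_zero, qInt_zero,
      zero_smul, add_zero, Nat.add_sub_cancel, Fin.val_zero, Fin.val_one] <;>
    module

end Torus

/-- The element `(c k - c⁻¹ k⁻¹) / (q - q⁻¹)`. -/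
def bracket {A : Type*} [Ring A] [Algebra F A] (q c : F) (k : Aˣ) : A :=
  (q - q⁻¹)⁻¹ • (c • (k : A) - c⁻¹ • (↑k⁻¹ : A))

/-- The action of `e₁` on `Ind W`, given the actions `k` of `k₁` and `e` of `e₁` on `W`. It is
computed from `e₁ f₁ʷ = f₁ʷ e₁ + [w] f₁ʷ⁻¹ (q¹⁻ʷ k₁ - qʷ⁻¹ k₁⁻¹) / (q - q⁻¹)`, `e₁ f₂ = f₂ e₁` and
`e₁ f₃ = f₃ e₁ - q f₂ k₁`. -/
def e₁ (q : F) (k : (End F W)ˣ) (e : End F W) : End F (Ind W) := lift fun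
  | w, 0, 0 => vec F w 0 0 ∘ₗ e + qInt q w • vec F (w - 1) 0 0 ∘ₗ bracket q (q / q ^ w) k
  | w, 0, 1 => vec F w 0 1 ∘ₗ e + qInt q w • vec F (w - 1) 0 1 ∘ₗ bracket q (q ^ 2 / q ^ w) k
  | w, 1, 0 => vec F w 1 0 ∘ₗ e + qInt q w • vec F (w - 1) 1 0 ∘ₗ bracket q (1 / q ^ w) k
      - q • vec F w 0 1 ∘ₗ (k : End F W)
  | w, 1, 1 => vec F w 1 1 ∘ₗ e + qInt q w • vec F (w - 1) 1 1 ∘ₗ bracket q (q / q ^ w) k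

/-- The action of `e₂` on `Ind W`, given the actions `k` of `k₂` and `e` of `e₂` on `W`. It is
computed from `e₂ f₁ = f₁ e₂`, `e₂ f₂ = -f₂ e₂ + (k₂ - k₂⁻¹) / (q - q⁻¹)` and
`e₂ f₃ = -f₃ e₂ + f₁ k₂⁻¹`. -/
def e₂ (q : F) (k : (End F W)ˣ) (e : End F W) : End F (Ind W) := lift fun
  | w, 0, 0 => vec F w 0 0 ∘ₗ e
  | w, 0, 1 => vec F w 0 0 ∘ₗ bracket q 1 k - vec F w 0 1 ∘ₗ e
  | w, 1, 0 => vec F (w + 1) 0 0 ∘ₗ (↑k⁻¹ : End F W) - vec F w 1 0 ∘ₗ e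
  | w, 1, 1 => vec F w 1 1 ∘ₗ e - vec F w 1 0 ∘ₗ bracket q 1 k
      + vec F (w + 1) 0 1 ∘ₗ (↑k⁻¹ : End F W)

section Raising

variable (q : F) (k : (End F W)ˣ) (e : End F W)

theorem bracket_apply (c : F) (x : W) :
    bracket q c k x =
      (q - q⁻¹)⁻¹ • (c • (k : End F W) x - c⁻¹ • (↑k⁻¹ : End F W) x) := rfl

variable (w : ℕ) (x : W)

theorem e₁_vec_zero_zero : e₁ q k e (vec F w 0 0 x) =
    vec F w 0 0 (e x) + qInt q w • vec F (w - 1) 0 0 (bracket q (q / q ^ w) k x) := lift_vec ..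

theorem e₁_vec_zero_one : e₁ q k e (vec F w 0 1 x) =
    vec F w 0 1 (e x) + qInt q w • vec F (w - 1) 0 1 (bracket q (q ^ 2 / q ^ w) k x) := lift_vec ..

theorem e₁_vec_one_zero : e₁ q k e (vec F w 1 0 x) =
    vec F w 1 0 (e x) + qInt q w • vec F (w - 1) 1 0 (bracket q (1 / q ^ w) k x)
      - q • vec F w 0 1 ((k : End F W) x) := lift_vec ..

theorem e₁_vec_one_one : e₁ q k e (vec F w 1 1 x) =
    vec F w 1 1 (e x) + qInt q w • vec F (w - 1) 1 1 (bracket q (q / q ^ w) k x) := lift_vec ..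

theorem e₂_vec_zero_zero : e₂ q k e (vec F w 0 0 x) = vec F w 0 0 (e x) := lift_vec ..

theorem e₂_vec_zero_one : e₂ q k e (vec F w 0 1 x) =
    vec F w 0 0 (bracket q 1 k x) - vec F w 0 1 (e x) := lift_vec ..

theorem e₂_vec_one_zero : e₂ q k e (vec F w 1 0 x) =
    vec F (w + 1) 0 0 ((↑k⁻¹ : End F W) x) - vec F w 1 0 (e x) := lift_vec ..

theorem e₂_vec_one_one : e₂ q k e (vec F w 1 1 x) =
    vec F w 1 1 (e x) - vec F w 1 0 (bracket q 1 k x)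
      + vec F (w + 1) 0 1 ((↑k⁻¹ : End F W) x) := lift_vec ..

end Raising

section CrossRelations

variable {q : F} (hq : q ≠ 0) (k : (End F W)ˣ)

/-- The action of `k₁` on `Ind W`, given its action `k` on `W`. -/
def k₁ : (End F (Ind W))ˣ := torus ((Units.mk0 q hq)⁻¹ ^ 2) (Units.mk0 q hq) k

/-- The action of `k₂` on `Ind W`, given its action `k` on `W`. -/
def k₂ : (End F (Ind W))ˣ := torus (Units.mk0 q hq) 1 k

section

variable (w : ℕ) (s l : Fin 2) (x : W)

theorem k₁_vec : (k₁ hq k : End F (Ind W)) (vec F w s l x) =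
    ((q⁻¹ ^ 2) ^ w * q⁻¹ ^ (s : ℕ) * q ^ (l : ℕ)) • vec F w s l ((k : End F W) x) := by
  have h : q⁻¹ ^ 2 * q = q⁻¹ := by field_simp
  simp only [k₁, torus_vec, Units.val_pow_eq_pow_val, Units.val_inv_eq_inv_val, Units.val_mk0, h]

theorem k₁_inv_vec : (↑(k₁ hq k)⁻¹ : End F (Ind W)) (vec F w s l x) =
    ((q ^ 2) ^ w * q ^ (s : ℕ) * q⁻¹ ^ (l : ℕ)) • vec F w s l ((↑k⁻¹ : End F W) x) := by
  have h : q ^ 2 * q⁻¹ = q := by field_simp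
  simp only [k₁, torus_inv, torus_vec, ← inv_pow, inv_inv, Units.val_pow_eq_pow_val,
    Units.val_inv_eq_inv_val, Units.val_mk0, h]

theorem k₂_vec : (k₂ hq k : End F (Ind W)) (vec F w s l x) =
    (q ^ w * q ^ (s : ℕ)) • vec F w s l ((k : End F W) x) := by
  simp only [k₂, torus_vec, Units.val_one, Units.val_mk0, mul_one, one_pow]

theorem k₂_inv_vec : (↑(k₂ hq k)⁻¹ : End F (Ind W)) (vec F w s l x) =
    (q⁻¹ ^ w * q⁻¹ ^ (s : ℕ)) • vec F w s l ((↑k⁻¹ : End F W) x) := by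
  simp only [k₂, torus_inv, torus_vec, inv_one, Units.val_one, Units.val_inv_eq_inv_val,
    Units.val_mk0, mul_one, one_pow]

end

theorem k₁_mul_f₁ :
    (k₁ hq k : End F (Ind W)) * f₁ F = q⁻¹ ^ 2 • (f₁ F * (k₁ hq k : End F (Ind W))) := by
  rw [k₁, torus_mul_f₁, Units.val_pow_eq_pow_val, Units.val_inv_eq_inv_val, Units.val_mk0]

theorem k₁_mul_f₂ :
    (k₁ hq k : End F (Ind W)) * f₂ q = q • (f₂ q * (k₁ hq k : End F (Ind W))) :=
  torus_mul_f₂ _ _ k q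

theorem k₂_mul_f₁ :
    (k₂ hq k : End F (Ind W)) * f₁ F = q • (f₁ F * (k₂ hq k : End F (Ind W))) :=
  torus_mul_f₁ _ _ k

theorem k₂_mul_f₂ :
    (k₂ hq k : End F (Ind W)) * f₂ q = f₂ q * (k₂ hq k : End F (Ind W)) := by
  rw [k₂, torus_mul_f₂, Units.val_one, one_smul]

variable (e : End F W)

theorem e₁_mul_f₁ (hq2 : q ^ 2 ≠ 1) : e₁ q k e * f₁ F =
    f₁ F * e₁ q k e +
      (q - q⁻¹)⁻¹ • ((k₁ hq k : End F (Ind W)) - (↑(k₁ hq k)⁻¹ : End F (Ind W))) := by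
  have := sub_ne_zero.2 hq2
  refine hom_ext' ?_ ?_ ?_ ?_ <;> rintro (_ | w) x <;>
    simp only [Module.End.mul_apply, LinearMap.add_apply, LinearMap.sub_apply,
      LinearMap.smul_apply, f₁_vec, e₁_vec_zero_zero, e₁_vec_zero_one, e₁_vec_one_zero,
      e₁_vec_one_one, k₁_vec, k₁_inv_vec, bracket_apply, map_add, map_sub, map_smul, inv_pow,
      qInt_zero, zero_smul, add_zero, Nat.add_sub_cancel, Fin.val_zero, Fin.val_one] <;>
    match_scalars <;> (try simp only [qInt]) <;> field_simp <;> ring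

include hq in
theorem e₁_mul_f₂ (hq2 : q ^ 2 ≠ 1) : e₁ q k e * f₂ q = f₂ q * e₁ q k e := by
  have := sub_ne_zero.2 hq2
  refine hom_ext' ?_ ?_ ?_ ?_ <;> rintro (_ | _ | w) x <;>
    simp only [Module.End.mul_apply, f₂_vec_zero_zero, f₂_vec_zero_one, f₂_vec_one_zero,
      f₂_vec_one_one, e₁_vec_zero_zero, e₁_vec_zero_one, e₁_vec_one_zero, e₁_vec_one_one,
      bracket_apply, map_add, map_sub, map_smul, map_zero, qInt_zero, zero_smul, smul_zero,
      add_zero, Nat.add_sub_cancel] <;>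
    match_scalars <;> (try simp only [qInt]) <;> field_simp <;> ring

theorem e₂_mul_f₁ (q : F) : e₂ q k e * f₁ F = f₁ F * e₂ q k e := by
  refine hom_ext' ?_ ?_ ?_ ?_ <;> intro w x <;>
    simp only [Module.End.mul_apply, f₁_vec, e₂_vec_zero_zero, e₂_vec_zero_one, e₂_vec_one_zero,
      e₂_vec_one_one, map_add, map_sub]

theorem e₂_mul_f₂ (hq2 : q ^ 2 ≠ 1) : e₂ q k e * f₂ q =
    -(f₂ q * e₂ q k e) +
      (q - q⁻¹)⁻¹ • ((k₂ hq k : End F (Ind W)) - (↑(k₂ hq k)⁻¹ : End F (Ind W))) := by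
  have := sub_ne_zero.2 hq2
  refine hom_ext' ?_ ?_ ?_ ?_ <;> rintro (_ | w) x <;>
    simp only [Module.End.mul_apply, LinearMap.add_apply, LinearMap.sub_apply, LinearMap.neg_apply,
      LinearMap.smul_apply, f₂_vec_zero_zero, f₂_vec_zero_one, f₂_vec_one_zero,
      f₂_vec_one_one, e₂_vec_zero_zero, e₂_vec_zero_one, e₂_vec_one_zero, e₂_vec_one_one,
      k₂_vec, k₂_inv_vec, bracket_apply, inv_pow, map_add, map_sub, map_smul, map_zero, qInt_zero,
      zero_smul, add_zero, Nat.add_sub_cancel, Fin.val_zero, Fin.val_one] <;>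
    match_scalars <;> (try simp only [qInt]) <;> field_simp <;> ring

end CrossRelations

end Ind

/-- A representation on `W` of the Borel subalgebra generated by `k₁^{±1}, k₂^{±1}, e₁, e₂`. -/
structure BorelRep {F : Type*} [Field F] (q : F) (W : Type*) [AddCommGroup W] [Module F W] where
  k₁ : (End F W)ˣ
  k₂ : (End F W)ˣ
  e₁ : End F W
  e₂ : End F W
  k₂_mul_k₁ : k₂ * k₁ = k₁ * k₂
  e₁_mul_k₁ : e₁ * k₁ = q⁻¹ ^ 2 • (k₁ * e₁ : End F W)
  e₂_mul_k₁ : e₂ * k₁ = q • (k₁ * e₂ : End F W)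
  e₁_mul_k₂ : e₁ * k₂ = q • (k₂ * e₁ : End F W)
  e₂_mul_k₂ : e₂ * k₂ = k₂ * e₂
  e₂_mul_self : e₂ * e₂ = 0
  e_serre : qSerre q e₁ e₂ = 0

namespace Ind

variable {F W : Type*} [Field F] [AddCommGroup W] [Module F W] {q : F}

section Top

variable (k : (End F W)ˣ) (x : W)

theorem k₁_top (hq : q ≠ 0) :
    (k₁ hq k : End F (Ind W)) (vec F 0 0 0 x) = vec F 0 0 0 ((k : End F W) x) := by
  simp only [k₁_vec, Fin.val_zero, pow_zero, mul_one, one_smul]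

theorem k₂_top (hq : q ≠ 0) :
    (k₂ hq k : End F (Ind W)) (vec F 0 0 0 x) = vec F 0 0 0 ((k : End F W) x) := by
  simp only [k₂_vec, Fin.val_zero, pow_zero, mul_one, one_smul]

variable (q) (e : End F W)

theorem e₁_top : e₁ q k e (vec F 0 0 0 x) = vec F 0 0 0 (e x) := by
  simp only [e₁_vec_zero_zero, qInt_zero, zero_smul, add_zero]

theorem e₂_top : e₂ q k e (vec F 0 0 0 x) = vec F 0 0 0 (e x) := e₂_vec_zero_zero ..

end Top

theorem mul_eq_smul_mul_of_top (hq : q ≠ 0) (hq2 : q ^ 2 ≠ 1) {E K : End F (Ind W)}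
    {e k : End F W} {c : F} (hE : ∀ x, E (vec F 0 0 0 x) = vec F 0 0 0 (e x))
    (hK : ∀ x, K (vec F 0 0 0 x) = vec F 0 0 0 (k x)) (h : e * k = c • (k * e))
    (h₁ : SkewCommute F (E * K - c • (K * E)) (f₁ F))
    (h₂ : SkewCommute F (E * K - c • (K * E)) (f₂ q)) : E * K = c • (K * E) := by
  refine sub_eq_zero.1 (eq_zero_of_skewCommute hq hq2 (fun x => ?_) h₁ h₂)
  simpa only [LinearMap.sub_apply, LinearMap.smul_apply, Module.End.mul_apply, hE, hK, map_smul,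
    sub_eq_zero] using congrArg (vec F 0 0 0) (LinearMap.congr_fun h x)

section BorelRelations

variable (hq : q ≠ 0) (B : BorelRep q W)

theorem k₂_mul_k₁ : k₂ hq B.k₂ * k₁ hq B.k₁ = k₁ hq B.k₁ * k₂ hq B.k₂ :=
  torus_commute _ _ B.k₂_mul_k₁ _ _

theorem commute_k₁_k₂ : Commute (k₁ hq B.k₁ : End F (Ind W)) (k₂ hq B.k₂ : End F (Ind W)) :=
  congrArg Units.val (k₂_mul_k₁ hq B).symm

variable (hq2 : q ^ 2 ≠ 1)

include hq2

theorem e₁_mul_k₁ :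
    e₁ q B.k₁ B.e₁ * k₁ hq B.k₁ = q⁻¹ ^ 2 • (k₁ hq B.k₁ * e₁ q B.k₁ B.e₁ : End F (Ind W)) :=
  mul_eq_smul_mul_of_top hq hq2 (e₁_top _ _ · _) (k₁_top _ · hq) B.e₁_mul_k₁
    (skewCommute_defect (ε := 1) (k₁_mul_f₁ hq _) (by rw [e₁_mul_f₁ hq _ _ hq2, one_smul])
      (commute_smul_sub_inv (.refl _) _))
    (skewCommute_defect_of_commute _ (k₁_mul_f₂ hq _) (e₁_mul_f₂ hq _ _ hq2))

theorem e₂_mul_k₁ :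
    e₂ q B.k₂ B.e₂ * k₁ hq B.k₁ = q • (k₁ hq B.k₁ * e₂ q B.k₂ B.e₂ : End F (Ind W)) :=
  mul_eq_smul_mul_of_top hq hq2 (e₂_top _ _ · _) (k₁_top _ · hq) B.e₂_mul_k₁
    (skewCommute_defect_of_commute _ (k₁_mul_f₁ hq _) (e₂_mul_f₁ _ _ _))
    (skewCommute_defect (ε := -1) (k₁_mul_f₂ hq _)
      (by rw [e₂_mul_f₂ hq _ _ hq2, neg_one_smul]) (commute_smul_sub_inv (commute_k₁_k₂ hq B) _))

theorem e₁_mul_k₂ :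
    e₁ q B.k₁ B.e₁ * k₂ hq B.k₂ = q • (k₂ hq B.k₂ * e₁ q B.k₁ B.e₁ : End F (Ind W)) :=
  mul_eq_smul_mul_of_top hq hq2 (e₁_top _ _ · _) (k₂_top _ · hq) B.e₁_mul_k₂
    (skewCommute_defect (ε := 1) (k₂_mul_f₁ hq _) (by rw [e₁_mul_f₁ hq _ _ hq2, one_smul])
      (commute_smul_sub_inv (commute_k₁_k₂ hq B).symm _))
    (skewCommute_defect_of_commute (a := 1) _ (by rw [k₂_mul_f₂, one_smul])
      (e₁_mul_f₂ hq _ _ hq2))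

theorem e₂_mul_k₂ :
    e₂ q B.k₂ B.e₂ * k₂ hq B.k₂ = (k₂ hq B.k₂ * e₂ q B.k₂ B.e₂ : End F (Ind W)) := by
  rw [← one_smul F (_ * e₂ q B.k₂ B.e₂)]
  exact mul_eq_smul_mul_of_top hq hq2 (e₂_top _ _ · _) (k₂_top _ · hq)
    (by rw [B.e₂_mul_k₂, one_smul])
    (skewCommute_defect_of_commute _ (k₂_mul_f₁ hq _) (e₂_mul_f₁ _ _ _))
    (skewCommute_defect (ε := -1) (by rw [k₂_mul_f₂, one_smul])
      (by rw [e₂_mul_f₂ hq _ _ hq2, neg_one_smul]) (commute_smul_sub_inv (.refl _) _))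

include hq

theorem e₂_mul_self : e₂ q B.k₂ B.e₂ * e₂ q B.k₂ B.e₂ = 0 := by
  have commute_bracket : Commute (e₂ q B.k₂ B.e₂) ((q - q⁻¹)⁻¹ •
      ((k₂ hq B.k₂ : End F (Ind W)) - (↑(k₂ hq B.k₂)⁻¹ : End F (Ind W)))) :=
    (commute_smul_sub_inv (e₂_mul_k₂ hq B hq2) _).symm
  refine eq_zero_of_skewCommute hq hq2 (fun x => ?_) ⟨1, ?_⟩ ⟨1, ?_⟩
  · rw [Module.End.mul_apply, e₂_top, e₂_top, ← Module.End.mul_apply, B.e₂_mul_self,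
      LinearMap.zero_apply, map_zero]
  · have e₂_f₁ : Commute (e₂ q B.k₂ B.e₂) (f₁ F) := e₂_mul_f₁ _ _ _
    rw [(e₂_f₁.mul_left e₂_f₁).eq, one_smul]
  · rw [(mul_self_commute_of_mul_eq_neg_add (e₂_mul_f₂ hq _ _ hq2) commute_bracket).eq, one_smul]

theorem e_serre : qSerre q (e₁ q B.k₁ B.e₁) (e₂ q B.k₂ B.e₂) = 0 := by
  refine eq_zero_of_skewCommute hq hq2 (fun x => ?_) ⟨1, ?_⟩ ⟨-1, ?_⟩
  · simpa only [qSerre, pow_two, LinearMap.add_apply, LinearMap.sub_apply, LinearMap.smul_apply,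
      Module.End.mul_apply, e₁_top, e₂_top, map_add, map_sub, map_smul, map_zero,
      LinearMap.zero_apply] using congrArg (vec F 0 0 0) (LinearMap.congr_fun B.e_serre x)
  · rw [one_smul]
    exact qSerre_mul_of_left hq (e₁_mul_f₁ hq _ _ hq2) (e₂_mul_f₁ _ _ _) (e₁_mul_k₁ hq B hq2)
      (e₂_mul_k₁ hq B hq2)
  · rw [neg_one_smul]
    exact qSerre_mul_of_right hq (e₁_mul_f₂ hq _ _ hq2) (e₂_mul_f₂ hq _ _ hq2)
      (e₁_mul_k₂ hq B hq2)

end BorelRelations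

end Ind

/-! ### Linear independence -/

namespace BorelRep

variable {F W : Type*} [Field F] [AddCommGroup W] [Module F W] {q : F}

section Induced

variable (hq : q ≠ 0) (hq2 : q ^ 2 ≠ 1) (B : BorelRep q W)

/-- The action of the generators of `U_q` on the module induced from `B`. -/
def indGen : Gen → End F (Ind W)
  | .k₁ => Ind.k₁ hq B.k₁
  | .k₁inv => ↑(Ind.k₁ hq B.k₁)⁻¹
  | .k₂ => Ind.k₂ hq B.k₂
  | .k₂inv => ↑(Ind.k₂ hq B.k₂)⁻¹
  | .e₁ => Ind.e₁ q B.k₁ B.e₁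
  | .e₂ => Ind.e₂ q B.k₂ B.e₂
  | .f₁ => Ind.f₁ F
  | .f₂ => Ind.f₂ q

include hq2 in
theorem lift_indGen_eq_of_rel ⦃x y : FreeAlgebra F Gen⦄ (h : Rel F q x y) :
    FreeAlgebra.lift F (B.indGen hq) x = FreeAlgebra.lift F (B.indGen hq) y := by
  cases h <;>
    simp only [map_mul, map_add, map_sub, map_neg, map_smul, map_pow, map_one, map_zero,
      FreeAlgebra.lift_ι_apply, indGen, Units.mul_inv, Units.inv_mul]
  case k₂_k₁ => exact congrArg Units.val (Ind.k₂_mul_k₁ hq B)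
  case e₁_k₁ => exact Ind.e₁_mul_k₁ hq B hq2
  case e₂_k₁ => exact Ind.e₂_mul_k₁ hq B hq2
  case e₁_k₂ => exact Ind.e₁_mul_k₂ hq B hq2
  case e₂_k₂ => exact Ind.e₂_mul_k₂ hq B hq2
  case k₁_f₁ => exact Ind.k₁_mul_f₁ hq _
  case k₁_f₂ => exact Ind.k₁_mul_f₂ hq _
  case k₂_f₁ => exact Ind.k₂_mul_f₁ hq _
  case k₂_f₂ => exact Ind.k₂_mul_f₂ hq _
  case e₁_f₁ => exact Ind.e₁_mul_f₁ hq _ _ hq2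
  case e₂_f₂ => exact Ind.e₂_mul_f₂ hq _ _ hq2
  case e₁_f₂ => exact Ind.e₁_mul_f₂ hq _ _ hq2
  case e₂_f₁ => exact Ind.e₂_mul_f₁ _ _ q
  case e₂_sq => rw [pow_two, Ind.e₂_mul_self hq B hq2]
  case f₂_sq => rw [pow_two, Ind.f₂_mul_self]
  case e_serre => exact Ind.e_serre hq B hq2
  case f_serre => exact Ind.f_serre hq hq2

/-- The representation of `U_q` induced from a representation `B` of the Borel subalgebra. -/
def ind : Uq F q →ₐ[F] End F (Ind W) :=
  RingQuot.liftAlgHom F ⟨FreeAlgebra.lift F (B.indGen hq), B.lift_indGen_eq_of_rel hq hq2⟩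

theorem ind_proj (x : FreeAlgebra F Gen) :
    B.ind hq hq2 (Uq.proj q x) = FreeAlgebra.lift F (B.indGen hq) x :=
  RingQuot.liftAlgHom_mkAlgHom_apply ..

theorem ind_proj_gen (x : Gen) : B.ind hq hq2 (Uq.proj q (gen F x)) = B.indGen hq x := by
  rw [ind_proj, FreeAlgebra.lift_ι_apply]

theorem ind_k₁_zpow (n : ℤ) : B.ind hq hq2 ↑(Uq.k₁ q ^ n) = ↑(Ind.k₁ hq B.k₁ ^ n) := by
  have map_k₁ : Units.map (B.ind hq hq2 : Uq F q →* End F (Ind W)) (Uq.k₁ q) = Ind.k₁ hq B.k₁ :=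
    Units.ext (B.ind_proj_gen hq hq2 .k₁)
  rw [← map_k₁, ← map_zpow]
  rfl

theorem ind_k₂_zpow (n : ℤ) : B.ind hq hq2 ↑(Uq.k₂ q ^ n) = ↑(Ind.k₂ hq B.k₂ ^ n) := by
  have map_k₂ : Units.map (B.ind hq hq2 : Uq F q →* End F (Ind W)) (Uq.k₂ q) = Ind.k₂ hq B.k₂ :=
    Units.ext (B.ind_proj_gen hq hq2 .k₂)
  rw [← map_k₂, ← map_zpow]
  rfl

theorem ind_e₁ : B.ind hq hq2 (Uq.e₁ q) = Ind.e₁ q B.k₁ B.e₁ := B.ind_proj_gen hq hq2 .e₁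

theorem ind_e₂ : B.ind hq hq2 (Uq.e₂ q) = Ind.e₂ q B.k₂ B.e₂ := B.ind_proj_gen hq hq2 .e₂

theorem ind_f₁ : B.ind hq hq2 (Uq.f₁ q) = Ind.f₁ F := B.ind_proj_gen hq hq2 .f₁

theorem ind_f₂ : B.ind hq hq2 (Uq.f₂ q) = Ind.f₂ q := B.ind_proj_gen hq hq2 .f₂

end Induced

end BorelRep

/-- The Borel subalgebra acting on itself by left multiplication. The summand indexed by
`(i, j)` is `k₁ⁱ k₂ʲ` times the subalgebra generated by `e₁, e₂`, which satisfy the same relations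
as `f₁, f₂` and hence act on it through the operators `Ind.f₁` and `Ind.f₂`. -/
def BorelRep.regular {F : Type*} [Field F] {q : F} (hq : q ≠ 0) (hq2 : q ^ 2 ≠ 1) :
    BorelRep q (ℤ × ℤ →₀ Ind F) where
  k₁ := shift F _ (.ofAdd (1, 0))
  k₂ := shift F _ (.ofAdd (0, 1))
  e₁ := diagOp (fun z => q ^ (z.2 - 2 * z.1)) (Ind.f₁ F)
  e₂ := diagOp (fun z => q ^ z.1) (Ind.f₂ q)
  k₂_mul_k₁ := ((Commute.all _ _).map (shift F _)).eq
  e₁_mul_k₁ := diagOp_mul_shift (fun z => by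
    rw [← zpow_natCast, inv_zpow', ← zpow_add₀ hq]
    congr 1
    simp only [Prod.fst_add, Prod.snd_add, toAdd_ofAdd, Nat.cast_ofNat]
    ring) _
  e₂_mul_k₁ := diagOp_mul_shift (fun z => by rw [← zpow_one_add₀ hq]; rfl) _
  e₁_mul_k₂ := diagOp_mul_shift (fun z => by
    rw [← zpow_one_add₀ hq]
    congr 1
    simp only [Prod.fst_add, Prod.snd_add, toAdd_ofAdd]
    ring) _
  e₂_mul_k₂ := by rw [diagOp_mul_shift (r := 1) (fun z => by simp), one_smul]
  e₂_mul_self := by rw [diagOp_mul_diagOp, Ind.f₂_mul_self, map_zero]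
  e_serre := by rw [qSerre_diagOp, Ind.f_serre hq hq2, map_zero]

section Intertwiners

variable {F V W : Type*} [Field F] [AddCommGroup V] [Module F V] [AddCommGroup W] [Module F W]

/-- The pairs of operators on `V` and `W` intertwined by `φ`. -/
def intertwined (φ : V →ₗ[F] W) : Subalgebra F (End F V × End F W) where
  carrier := {p | ∀ x, p.2 (φ x) = φ (p.1 x)}
  mul_mem' hS hT x := by
    simp only [Prod.fst_mul, Prod.snd_mul, Module.End.mul_apply, hS _, hT _]
  add_mem' hS hT x := by
    simp only [Prod.fst_add, Prod.snd_add, LinearMap.add_apply, map_add, hS _, hT _]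
  algebraMap_mem' r x := (map_smul φ r x).symm

theorem qCommutator_mem_intertwined {φ : V →ₗ[F] W} {S S' : End F V} {T T' : End F W} (q : F)
    (h : (S, T) ∈ intertwined φ) (h' : (S', T') ∈ intertwined φ) :
    (qCommutator q S S', qCommutator q T T') ∈ intertwined φ :=
  sub_mem (mul_mem h h') (Subalgebra.smul_mem _ (mul_mem h' h) q)

end Intertwiners

namespace BorelRep

variable {F : Type*} [Field F] {q : F} (hq : q ≠ 0) (hq2 : q ^ 2 ≠ 1)

/-- The vector `1 ⊗ (1 ⊗ v)` of the module induced from the regular representation. -/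
def regularTop : Ind F →ₗ[F] Ind (ℤ × ℤ →₀ Ind F) := vec F 0 0 0 ∘ₗ lsingle 0

theorem ind_regular_e₁_mem :
    (Ind.f₁ F, (regular hq hq2).ind hq hq2 (Uq.e₁ q)) ∈ intertwined (regularTop (F := F)) :=
  fun x => by simp [ind_e₁, regularTop, Ind.e₁_top, regular, diagOp_single]

theorem ind_regular_e₂_mem :
    (Ind.f₂ q, (regular hq hq2).ind hq hq2 (Uq.e₂ q)) ∈ intertwined (regularTop (F := F)) :=
  fun x => by simp [ind_e₂, regularTop, Ind.e₂_top, regular, diagOp_single]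

theorem ind_regular_e₃_mem :
    (-q⁻¹ • qCommutator q (Ind.f₂ q) (Ind.f₁ F), (regular hq hq2).ind hq hq2 (Uq.e₃ q)) ∈
      intertwined (regularTop (F := F)) := by
  rw [Uq.e₃_eq_smul hq, qCommutator, qCommutator, map_smul, map_sub, map_mul, map_smul, map_mul]
  exact Subalgebra.smul_mem _ (qCommutator_mem_intertwined q (ind_regular_e₂_mem hq hq2)
    (ind_regular_e₁_mem hq hq2)) _

theorem ind_regular_raising_apply (r : ℕ) (h t : Fin 2) :
    (regular hq hq2).ind hq hq2 (Uq.e₁ q ^ r * Uq.e₃ q ^ (h : ℕ) * Uq.e₂ q ^ (t : ℕ))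
      (regularTop (vec F 0 0 0 1)) = (-q⁻¹) ^ (h : ℕ) • regularTop (vec F r h t 1) := by
  have raising_mem := mul_mem (mul_mem (pow_mem (ind_regular_e₁_mem hq hq2) r)
    (pow_mem (ind_regular_e₃_mem hq hq2) h)) (pow_mem (ind_regular_e₂_mem hq hq2) t)
  rw [map_mul, map_mul, map_pow, map_pow, map_pow]
  refine (raising_mem _).trans ?_
  simp only [Prod.fst_mul, Prod.pow_fst, smul_pow, mul_smul_comm, smul_mul_assoc,
    LinearMap.smul_apply, Ind.ordered_monomial_vec hq hq2, map_smul]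

theorem ind_regular_torus_apply (i j : ℤ) (y : Ind F) :
    (regular hq hq2).ind hq hq2 (↑(Uq.k₁ q ^ i) * ↑(Uq.k₂ q ^ j)) (regularTop y) =
      vec F 0 0 0 (single (i, j) y) := by
  have k₁_zpow (z : ℤ × ℤ) : (↑((regular hq hq2).k₁ ^ i) : End F _) (single z y) =
      single (i • (1, 0) + z) y := shift_zpow_single ..
  have k₂_zpow (z : ℤ × ℤ) : (↑((regular hq hq2).k₂ ^ j) : End F _) (single z y) =
      single (j • (0, 1) + z) y := shift_zpow_single ..
  rw [map_mul, Module.End.mul_apply, ind_k₁_zpow, ind_k₂_zpow, regularTop, LinearMap.comp_apply,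
    Finsupp.lsingle_apply, Ind.k₁, Ind.k₂, Ind.torus_zpow_vec_zero, Ind.torus_zpow_vec_zero,
    k₂_zpow, k₁_zpow]
  simp

theorem ind_lowering_apply {W : Type*} [AddCommGroup W] [Module F W] (B : BorelRep q W)
    (w : ℕ) (s l : Fin 2) (x : W) :
    B.ind hq hq2 (Uq.f₁ q ^ w * Uq.f₃ q ^ (s : ℕ) * Uq.f₂ q ^ (l : ℕ)) (vec F 0 0 0 x) =
      vec F w s l x := by
  rw [← Ind.ordered_monomial_vec hq hq2 w s l x]
  simp only [map_mul, map_pow, Uq.f₃, map_sub, map_smul, ind_f₁, ind_f₂, qCommutator]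

theorem ind_regular_monomial_apply (w : ℕ) (s l : Fin 2) (i j : ℤ) (r : ℕ) (h t : Fin 2) :
    (regular hq hq2).ind hq hq2 (Uq.monomial q (w, s, l, i, j, r, h, t))
      (regularTop (vec F 0 0 0 1)) =
      (-q⁻¹) ^ (h : ℕ) • vec F w s l (single (i, j) (vec F r h t (1 : F))) := by
  have monomial_eq : Uq.monomial q (w, s, l, i, j, r, h, t) =
      Uq.f₁ q ^ w * Uq.f₃ q ^ (s : ℕ) * Uq.f₂ q ^ (l : ℕ) *
        ((↑(Uq.k₁ q ^ i) * ↑(Uq.k₂ q ^ j)) *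
          (Uq.e₁ q ^ r * Uq.e₃ q ^ (h : ℕ) * Uq.e₂ q ^ (t : ℕ))) := by
    simp only [Uq.monomial, mul_assoc]
  rw [monomial_eq, map_mul _ _ (_ * _), map_mul _ (_ * _) (_ * _ * _), Module.End.mul_apply,
    Module.End.mul_apply, ind_regular_raising_apply, map_smul, map_smul,
    ind_regular_torus_apply, ind_lowering_apply]

end BorelRep

theorem linearIndependent_single_prod {R M ι κ : Type*} [Ring R] [AddCommGroup M] [Module R M]
    {v : κ → M} (hv : LinearIndependent R v) :
    LinearIndependent R fun p : ι × κ => single p.1 (v p.2) :=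
  (linearIndependent_equiv' (Equiv.sigmaEquivProd ι κ) rfl).1
    (Finsupp.linearIndependent_single (fun _ => v) fun _ => hv)

theorem linearIndependent_vec {F W κ : Type*} [Field F] [AddCommGroup W] [Module F W] {v : κ → W}
    (hv : LinearIndependent F v) :
    LinearIndependent F fun p : (ℕ × Fin 2 × Fin 2) × κ => vec F p.1.1 p.1.2.1 p.1.2.2 (v p.2) :=
  linearIndependent_single_prod hv

theorem linearIndependent_vec_one (F : Type*) [Field F] :
    LinearIndependent F fun p : ℕ × Fin 2 × Fin 2 => vec F p.1 p.2.1 p.2.2 (1 : F) :=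
  Finsupp.linearIndependent_single_one F (ℕ × Fin 2 × Fin 2)

theorem Uq.linearIndependent_monomial {F : Type*} [Field F] {q : F} (hq : q ≠ 0)
    (hq2 : q ^ 2 ≠ 1) : LinearIndependent F (monomial q) := by
  let evalTop : Uq F q →ₗ[F] Ind (ℤ × ℤ →₀ Ind F) :=
    LinearMap.applyₗ (BorelRep.regularTop (vec F 0 0 0 1)) ∘ₗ
      ((BorelRep.regular hq hq2).ind hq hq2).toLinearMap
  refine .of_comp evalTop ?_
  have regroup_injective : Function.Injective
      fun ((w, s, l, i, j, r, h, t) : ℕ × Fin 2 × Fin 2 × ℤ × ℤ × ℕ × Fin 2 × Fin 2) =>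
        ((w, s, l), (i, j), r, h, t) := fun x y h => by
    simp only [Prod.mk.injEq] at h
    simp only [Prod.ext_iff, h, and_self]
  have vec_single_vec := linearIndependent_vec (linearIndependent_single_prod (ι := ℤ × ℤ)
    (linearIndependent_vec_one F))
  convert (vec_single_vec.comp _ regroup_injective).units_smul fun x =>
    (-(Units.mk0 q hq)⁻¹) ^ (x.2.2.2.2.2.2.1 : ℕ) using 1
  ext1 x
  exact BorelRep.ind_regular_monomial_apply hq hq2 ..

end

end QuantumSl21

theorem mainTheorem4_general {F : Type*} [Field F] {q : F} (hq : q ≠ 0) (hq4 : q ^ 4 ≠ 1) :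
    ∃ b : Module.Basis (ℕ × Fin 2 × Fin 2 × ℤ × ℤ × ℕ × Fin 2 × Fin 2) F (QuantumSl21.Uq F q),
      ∀ x, b x = QuantumSl21.Uq.monomial q x := by
  have sq_ne_one : q ^ 2 ≠ 1 := fun h => hq4 (by rw [pow_mul q 2 2, h, one_pow])
  have sq_ne_neg_one : q ^ 2 ≠ -1 := fun h => hq4 (by rw [pow_mul q 2 2, h, neg_one_sq])
  exact ⟨.mk (QuantumSl21.Uq.linearIndependent_monomial hq sq_ne_one)
    (QuantumSl21.Uq.span_range_monomial hq sq_ne_neg_one).ge, fun x => Module.Basis.mk_apply ..⟩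

theorem mainTheorem4 {k F : Type*} [Field k] [CharZero k] [Field F] [Algebra k F]
    (q : F) (hq : Transcendental k q)
    (hF : IsFractionRing (Algebra.adjoin k ({q, q⁻¹} : Set F)) F) :
    ∃ b : Module.Basis (ℕ × Fin 2 × Fin 2 × ℤ × ℤ × ℕ × Fin 2 × Fin 2) F (QuantumSl21.Uq F q),
      ∀ x, b x = QuantumSl21.Uq.monomial q x := by
  exact mainTheorem4_general (by rintro rfl; exact hq isAlgebraic_zero)
    fun h => hq ⟨.X ^ 4 - .C 1, Polynomial.X_pow_sub_C_ne_zero (by norm_num) 1, by simp [h]⟩
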